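/- Let $k>0$, $c>0$ and $\nu>0$. Let $\Gamma_k(x)=\int_0^\infty t^{x-1}e^{-t^k/k}\,dt$ ($x>0$) and let $$W(z)=\sum_{n=0}^{\infty}\frac{(-c)^n}{n!\,\Gamma_k(nk+\nu+k)}\left(\frac z2\right)^{2n+\frac{\nu}{k}}$$ be the generalized $k$-Bessel function. Consider its normalizations $$f(z)=\left(2^{\frac{\nu}{k}}\Gamma_k(\nu+k)W(z)\right)^{\frac{k}{\nu}},\quad g(z)=2^{\frac{\nu}{k}}\Gamma_k(\nu+k)z^{1-\frac{\nu}{k}}W(z),\quad h(z)=2^{\frac{\nu}{k}}\Gamma_k(\nu+k)z^{1-\frac{\nu}{2k}}W(\sqrt z),$$ where powers and roots in $W$, $g$, $h$ are principal (removable singularities being removed), and $f(z)=z\,\varphi(z)^{k/\nu}$ with $\varphi(z)=2^{\nu/k}\Gamma_k(\nu+k)z^{-\nu/k}W(z)$, $\varphi(0)=1$, the power being the holomorphic branch that equals $1$ at $z=0$. For a function $F(z)=z+a_2z^2+\cdots$ let $$r^{\star}(F)=\sup\left\{r>0 : F \text{ is holomorphic in } |z|<r \text{ and } \operatorname{Re}\frac{zF'(z)}{F(z)}>0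 \text{ for all } |z|<r\right\}$$ be its radius of starlikeness (the quotient being $1$ at $z=0$). Then: (a) $\displaystyle 2\sqrt{\frac{\nu(\nu+k)}{c(\nu+2k)}}<r^{\star}(f)<2(\nu+2k)\sqrt{\frac{\nu(\nu+k)}{c\left((\nu+2k)^3-\nu(\nu+k)(\nu+4k)\right)}}$; (b) $\displaystyle 2\sqrt{\frac{\nu+k}{3c}}<r^{\star}(g)<2\sqrt{\frac{3(\nu+k)(\nu+2k)}{c(4\nu+13k)}}$; (c) $\displaystyle \frac{2(\nu+k)}{c}<r^{\star}(h)<\frac{8(\nu+k)(\nu+2k)}{c(\nu+5k)}$. -/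

import Mathlib

open MeasureTheory

noncomputable section

/-- The `k`-gamma function `Γ_k(x) = ∫₀^∞ t^(x-1) exp(-t^k / k) dt` (for `x > 0`). -/
def kGamma (k x : ℝ) : ℝ :=
  ∫ t in Set.Ioi (0 : ℝ), t ^ (x - 1) * Real.exp (-(t ^ k) / k)

/-- The generalized `k`-Bessel function
`W(z) = ∑ (-c)^n / (n! Γ_k(nk + ν + k)) (z/2)^(2n + ν/k)`, with principal powers. -/
def kBesselW (k ν c : ℝ) (z : ℂ) : ℂ :=
  ∑' n : ℕ, (((-c) ^ n / ((n.factorial : ℝ) * kGamma k (n * k + ν + k)) : ℝ) : ℂ) *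
    (z / 2) ^ (2 * (n : ℂ) + (ν : ℂ) / (k : ℂ))

/-- The normalizing constant `2^(ν/k) Γ_k(ν + k)`. -/
def kBesselConst (k ν : ℝ) : ℝ := (2 : ℝ) ^ (ν / k) * kGamma k (ν + k)

/-- `g(z) = 2^(ν/k) Γ_k(ν + k) z^(1 - ν/k) W(z)`. -/
def kBesselG (k ν c : ℝ) (z : ℂ) : ℂ :=
  (kBesselConst k ν : ℂ) * z ^ (1 - (ν : ℂ) / (k : ℂ)) * kBesselW k ν c z

/-- `h(z) = 2^(ν/k) Γ_k(ν + k) z^(1 - ν/(2k)) W(√z)`. -/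
def kBesselH (k ν c : ℝ) (z : ℂ) : ℂ :=
  (kBesselConst k ν : ℂ) * z ^ (1 - (ν : ℂ) / (2 * (k : ℂ))) *
    kBesselW k ν c (z ^ (1 / 2 : ℂ))

/-- `2^(ν/k) Γ_k(ν + k) z^(-ν/k) W(z)`, with its limit `1` filled in at the removable
singularity `z = 0`. -/
def kBesselPhi (k ν c : ℝ) (z : ℂ) : ℂ :=
  if z = 0 then 1
  else (kBesselConst k ν : ℂ) * z ^ (-((ν : ℂ) / (k : ℂ))) * kBesselW k ν c z

/-- The branch of `log φ` that vanishes at the origin, for `φ` holomorphic with `φ 0 = 1`: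
the integral of `φ' / φ` along the segment from `0` to `z`. It is meaningful at those `z` for which
`φ` has no zero on that segment. -/
def logBranch (φ : ℂ → ℂ) (z : ℂ) : ℂ :=
  ∫ t in (0 : ℝ)..1, z * deriv φ ((t : ℂ) * z) / φ ((t : ℂ) * z)

/-- `f(z) = (2^(ν/k) Γ_k(ν + k) W(z))^(k/ν)`, with the branch of the power that makes `f`
holomorphic around the origin with `f(z) = z + ⋯`, namely
`f(z) = z * (2^(ν/k) Γ_k(ν + k) z^(-ν/k) W(z))^(k/ν)` where the power is `1` at `z = 0`. -/
def kBesselF (k ν c : ℝ) (z : ℂ) : ℂ :=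
  z * Complex.exp ((k : ℂ) / (ν : ℂ) * logBranch (kBesselPhi k ν c) z)

/-- The radius of starlikeness of order `α`: the supremum of all `r > 0` such that `f` is
holomorphic in the disk `|z| < r` and `Re (z f'(z) / f(z)) > α` there. (For `f(z) = z + ⋯` the
quotient has the value `1` at the removable singularity `z = 0`, so only `z ≠ 0` is tested.) -/
def radiusOfStarlikenessOfOrder (α : ℝ) (f : ℂ → ℂ) : ℝ :=
  sSup {r : ℝ | 0 < r ∧ DifferentiableOn ℂ f (Metric.ball 0 r) ∧
    ∀ z ∈ Metric.ball (0 : ℂ) r, z ≠ 0 → α < (z * deriv f z / f z).re}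

/-- The radius of starlikeness (of order zero). -/
def radiusOfStarlikeness (f : ℂ → ℂ) : ℝ := radiusOfStarlikenessOfOrder 0 f

end

/-! Put m = ν/k, κ = c/(4k) and B_m(s) = ∑ (-s)^n / (n! (m+1)_n). Then h = z B_m(κz), g = z B_m(κz²)
and f = z B_m(κz²)^(1/m), so in each case zF'/F = 1 + β s B_m'(s)/B_m(s) with s = κz^p, where (p, β)
is (1, 1), (2, 2) and (2, 2/m) respectively. Nothing about the location of Bessel zeros is needed,
only B_m' = -B_{m+1}/(m+1) and the recurrence B_m = B_{m+1} - s B_{m+2}/((m+1)(m+2)).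

Lower bounds: run downwards from a large index, where B is close to 1, the recurrence bounds
|B_{m+1}/B_m| on disks (`norm_besselB_succ_le`). Hence |β s B_m'/B_m| < 1 on a disk slightly larger
than |s| ≤ (m+1)/(1+β) (`exists_starlike_bound`).

Upper bounds: on the positive axis the quotient becomes nonpositive, with B_m still positive, no
later than s = (m+1)(m+2)/(β(m+2)+1) (`exists_pos_and_add_deriv_nonpos`). This threshold is strictly
below the three claimed ones by algebra. -/

/-! ### The series B_m: coefficients, derivative, recurrence. -/

/-- The Taylor coefficients `1 / (n! (m + 1)_n)`. -/
noncomputable def besselCoeff (m : ℝ) (n : ℕ) : ℝ :=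
  1 / ((n.factorial : ℝ) * (ascPochhammer ℝ n).eval (m + 1))

/-- The entire function `∑ (-s)^n / (n! (m + 1)_n)`. -/
noncomputable def besselB (m : ℝ) (s : ℂ) : ℂ :=
  ∑' n : ℕ, (besselCoeff m n : ℂ) * (-s) ^ n

lemma eval_ascPochhammer_succ_left (n : ℕ) (x : ℝ) :
    (ascPochhammer ℝ (n + 1)).eval x = x * (ascPochhammer ℝ n).eval (x + 1) := by
  simp [ascPochhammer_succ_left]

lemma one_le_eval_ascPochhammer {x : ℝ} (hx : 1 ≤ x) (n : ℕ) :
    1 ≤ (ascPochhammer ℝ n).eval x := by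
  induction n with
  | zero => simp
  | succ n ih =>
    rw [ascPochhammer_succ_eval]
    have : (0 : ℝ) ≤ n := n.cast_nonneg
    nlinarith

lemma besselCoeff_pos {m : ℝ} (hm : 0 ≤ m) (n : ℕ) : 0 < besselCoeff m n := by
  have := one_le_eval_ascPochhammer (x := m + 1) (by linarith) n
  unfold besselCoeff
  positivity

lemma besselCoeff_zero (m : ℝ) : besselCoeff m 0 = 1 := by simp [besselCoeff]

lemma besselCoeff_le {m : ℝ} (hm : 0 ≤ m) (n : ℕ) : besselCoeff m n ≤ 1 / n.factorial := by
  have := one_le_eval_ascPochhammer (x := m + 1) (by linarith) n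
  have h : (0 : ℝ) < n.factorial := by positivity
  unfold besselCoeff
  apply one_div_le_one_div_of_le h
  nlinarith

lemma besselCoeff_succ_deriv {m : ℝ} (hm : 0 ≤ m) (n : ℕ) :
    ((n : ℝ) + 1) * besselCoeff m (n + 1) = besselCoeff (m + 1) n / (m + 1) := by
  have := one_le_eval_ascPochhammer (x := m + 1 + 1) (by linarith) n
  unfold besselCoeff
  rw [eval_ascPochhammer_succ_left, Nat.factorial_succ]
  push_cast
  have h : (0 : ℝ) < n.factorial := by positivity
  field_simp

lemma besselCoeff_succ_le {m : ℝ} (hm : 0 ≤ m) (n : ℕ) :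
    besselCoeff m (n + 1) ≤ (1 / n.factorial) / (m + 1) := by
  have h1 := besselCoeff_succ_deriv hm n
  have h2 := besselCoeff_le (m := m + 1) (by linarith) n
  have h3 := besselCoeff_pos hm (n + 1)
  calc besselCoeff m (n + 1) ≤ ((n : ℝ) + 1) * besselCoeff m (n + 1) := by
        have : (0 : ℝ) ≤ n := n.cast_nonneg
        nlinarith
    _ = besselCoeff (m + 1) n / (m + 1) := h1
    _ ≤ _ := by gcongr

lemma besselCoeff_succ_rec {m : ℝ} (hm : 0 ≤ m) (n : ℕ) :
    besselCoeff m (n + 1) =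
      besselCoeff (m + 1) (n + 1) + besselCoeff (m + 2) n / ((m + 1) * (m + 2)) := by
  have h1 := one_le_eval_ascPochhammer (x := m + 2) (by linarith) n
  have h2 := eval_ascPochhammer_succ_left n (m + 2)
  rw [ascPochhammer_succ_eval] at h2
  have h3 : (ascPochhammer ℝ n).eval (m + 2 + 1) =
      (ascPochhammer ℝ n).eval (m + 2) * (m + 2 + n) / (m + 2) := by
    rw [h2]; field_simp
  unfold besselCoeff
  rw [eval_ascPochhammer_succ_left, ascPochhammer_succ_eval, show m + 1 + 1 = m + 2 by ring, h3,
    Nat.factorial_succ]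
  push_cast
  have h : (0 : ℝ) < n.factorial := by positivity
  have hn : (0 : ℝ) ≤ n := n.cast_nonneg
  have : 0 < m + 2 + n := by linarith
  field_simp
  ring

lemma norm_besselB_term_le {m : ℝ} (hm : 0 ≤ m) {s : ℂ} {r : ℝ} (hs : ‖s‖ ≤ r) (n : ℕ) :
    ‖(besselCoeff m n : ℂ) * (-s) ^ n‖ ≤ r ^ n / n.factorial := by
  have h := besselCoeff_pos hm n
  rw [norm_mul, norm_pow, norm_neg, Complex.norm_real, Real.norm_of_nonneg h.le]
  calc _ ≤ (1 / n.factorial) * r ^ n := by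
        gcongr
        exact besselCoeff_le hm n
    _ = _ := by ring

lemma summable_besselB {m : ℝ} (hm : 0 ≤ m) (s : ℂ) :
    Summable fun n : ℕ => (besselCoeff m n : ℂ) * (-s) ^ n :=
  Summable.of_norm_bounded (Real.summable_pow_div_factorial ‖s‖)
    fun n => norm_besselB_term_le hm le_rfl n

lemma besselB_eq_one_add {m : ℝ} (hm : 0 ≤ m) (s : ℂ) :
    besselB m s = 1 + ∑' n : ℕ, (besselCoeff m (n + 1) : ℂ) * (-s) ^ (n + 1) := by
  rw [besselB, (summable_besselB hm s).tsum_eq_zero_add]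
  simp [besselCoeff_zero]

lemma hasDerivAt_besselB {m : ℝ} (hm : 0 ≤ m) (s : ℂ) :
    HasDerivAt (besselB m) (-besselB (m + 1) s / (m + 1)) s := by
  have hopen : IsOpen (Metric.ball (0 : ℂ) (‖s‖ + 1)) := Metric.isOpen_ball
  have hs : s ∈ Metric.ball (0 : ℂ) (‖s‖ + 1) := by simp
  have hb : ∀ (i : ℕ) (w : ℂ), w ∈ Metric.ball (0 : ℂ) (‖s‖ + 1) →
      ‖(besselCoeff m i : ℂ) * (-w) ^ i‖ ≤ (‖s‖ + 1) ^ i / i.factorial := fun i w hw =>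
    norm_besselB_term_le hm (by simpa using (mem_ball_zero_iff.1 hw).le) i
  have hd : ∀ i : ℕ, DifferentiableOn ℂ (fun w : ℂ => (besselCoeff m i : ℂ) * (-w) ^ i)
      (Metric.ball (0 : ℂ) (‖s‖ + 1)) := fun i => by fun_prop
  have hu := Real.summable_pow_div_factorial (‖s‖ + 1)
  have h1 := Complex.hasSum_deriv_of_summable_norm hu hd hopen hb hs
  have h2 : DifferentiableAt ℂ (besselB m) s :=
    (Complex.differentiableOn_tsum_of_summable_norm hu hd hopen hb).differentiableAt
      (hopen.mem_nhds hs)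
  have h3 : HasSum (fun i : ℕ => deriv (fun w : ℂ => (besselCoeff m i : ℂ) * (-w) ^ i) s)
      (deriv (besselB m) s) := h1
  have h4 : (fun i : ℕ => deriv (fun w : ℂ => (besselCoeff m (i + 1) : ℂ) * (-w) ^ (i + 1)) s) =
      fun i => (besselCoeff (m + 1) i : ℂ) * (-s) ^ i * (-1 / (m + 1)) := by
    funext i
    have h5 : HasDerivAt (fun w : ℂ => (besselCoeff m (i + 1) : ℂ) * (-w) ^ (i + 1))
      ((besselCoeff m (i + 1) : ℂ) * (((i + 1 : ℕ) : ℂ) * (-s) ^ i * (-1))) s :=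
      (((hasDerivAt_id s).neg).pow (i + 1)).const_mul _
    rw [h5.deriv]
    have h6 : ((i : ℂ) + 1) * besselCoeff m (i + 1) = besselCoeff (m + 1) i / (m + 1) := by
      exact_mod_cast congrArg (Complex.ofReal) (besselCoeff_succ_deriv hm i)
    push_cast
    linear_combination (-(-s) ^ i) * h6
  have h7 : deriv (besselB m) s = -besselB (m + 1) s / (m + 1) := by
    rw [← h3.tsum_eq, h3.summable.tsum_eq_zero_add, h4, tsum_mul_right, besselB]
    simp
    ring
  rw [← h7]
  exact h2.hasDerivAt

lemma besselB_rec {m : ℝ} (hm : 0 ≤ m) (s : ℂ) :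
    besselB m s = besselB (m + 1) s - s / ((m + 1) * (m + 2)) * besselB (m + 2) s := by
  have hs2 := summable_besselB (m := m + 2) (by linarith) s
  have hs1 := (summable_nat_add_iff 1).2 (summable_besselB (m := m + 1) (by linarith) s)
  rw [besselB_eq_one_add hm, besselB_eq_one_add (m := m + 1) (by linarith),
    besselB, ← tsum_mul_left, add_sub_assoc, ← hs1.tsum_sub (hs2.mul_left _)]
  congr 2
  funext n
  have h6 : (besselCoeff m (n + 1) : ℂ) =
      besselCoeff (m + 1) (n + 1) + besselCoeff (m + 2) n / ((m + 1) * (m + 2)) := by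
    exact_mod_cast congrArg (Complex.ofReal) (besselCoeff_succ_rec hm n)
  rw [h6]
  ring

/-- The factor 1/(m+1) forces B_m(s) → 1 as m → ∞ with s fixed; this starts the downward induction
in `norm_besselB_succ_le`. -/
lemma norm_besselB_sub_one_le {m : ℝ} (hm : 0 ≤ m) (s : ℂ) :
    ‖besselB m s - 1‖ ≤ ‖s‖ * Real.exp ‖s‖ / (m + 1) := by
  rw [besselB_eq_one_add hm, add_sub_cancel_left]
  have hsum : HasSum (fun n : ℕ => ‖s‖ ^ n / n.factorial) (Real.exp ‖s‖) := by
    rw [Real.exp_eq_exp_ℝ]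
    exact NormedSpace.expSeries_div_hasSum_exp ‖s‖
  refine tsum_of_norm_bounded ((hsum.mul_left ‖s‖).div_const (m + 1)) fun n => ?_
  have h := besselCoeff_pos hm (n + 1)
  rw [norm_mul, norm_pow, norm_neg, Complex.norm_real, Real.norm_of_nonneg h.le]
  calc _ ≤ ((1 / n.factorial) / (m + 1)) * ‖s‖ ^ (n + 1) := by
        gcongr
        exact besselCoeff_succ_le hm n
    _ = _ := by ring

lemma besselB_zero {m : ℝ} (hm : 0 ≤ m) : besselB m 0 = 1 := by
  simp [besselB_eq_one_add hm]

lemma besselB_ofReal (m x : ℝ) : besselB m x = ((besselB m x).re : ℂ) := by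
  have : besselB m x = ((∑' n : ℕ, besselCoeff m n * (-x) ^ n : ℝ) : ℂ) := by
    rw [besselB, Complex.ofReal_tsum]
    push_cast
    rfl
  rw [this, Complex.ofReal_re]

lemma hasDerivAt_re_besselB {m : ℝ} (hm : 0 ≤ m) (x : ℝ) :
    HasDerivAt (fun x : ℝ => (besselB m x).re) (-(besselB (m + 1) x).re / (m + 1)) x := by
  have h := (hasDerivAt_besselB hm (x : ℂ)).real_of_complex
  rw [besselB_ofReal] at h
  convert h using 1
  norm_cast

lemma re_besselB_rec {m : ℝ} (hm : 0 ≤ m) (x : ℝ) :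
    (besselB m x).re =
      (besselB (m + 1) x).re - x / ((m + 1) * (m + 2)) * (besselB (m + 2) x).re := by
  have h := besselB_rec hm (x : ℂ)
  rw [besselB_ofReal m, besselB_ofReal (m + 1), besselB_ofReal (m + 2)] at h
  exact_mod_cast h

/-! ### Positivity on the real axis, for the upper bounds. -/

/-- If `x F' + a F > 0` on `(0, s)` with `a > 0`, then `F s > 0`. -/
lemma pos_of_mul_deriv_add_mul_pos {F F' : ℝ → ℝ} {a s : ℝ} (ha : 0 < a) (hs : 0 < s)
    (hF : ∀ x, HasDerivAt F (F' x) x) (h : ∀ x ∈ Set.Ioo 0 s, 0 < x * F' x + a * F x) :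
    0 < F s := by
  have hcont : Continuous F := continuous_iff_continuousAt.2 fun x => (hF x).continuousAt
  have hmono : StrictMonoOn (fun x : ℝ => x ^ a * F x) (Set.Icc 0 s) := by
    refine strictMonoOn_of_deriv_pos (convex_Icc 0 s) ?_ fun x hx => ?_
    · exact ((Real.continuous_rpow_const ha.le).mul hcont).continuousOn
    · rw [interior_Icc] at hx
      have hx0 : 0 < x := hx.1
      have h1 := (Real.hasDerivAt_rpow_const (x := x) (p := a) (Or.inl hx0.ne')).mul (hF x)
      have h2 : deriv (fun x : ℝ => x ^ a * F x) x = a * x ^ (a - 1) * F x + x ^ a * F' x :=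
        h1.deriv
      have h3 : x ^ a = x ^ (a - 1) * x := by
        rw [← Real.rpow_add_one hx0.ne', sub_add_cancel]
      rw [h2, h3]
      have := mul_pos (Real.rpow_pos_of_pos hx0 (a - 1)) (h x hx)
      linarith
  have h1 := hmono (Set.left_mem_Icc.2 hs.le) (Set.right_mem_Icc.2 hs.le) hs
  simp only [Real.zero_rpow ha.ne', zero_mul] at h1
  exact pos_of_mul_pos_right h1 (by positivity)

/-- By the recurrence, x B_{m+1}' + (m+1) B_{m+1} = (m+1) B_m, so positivity passes from index m to
m+1. -/
lemma re_besselB_succ_pos {m s : ℝ} (hm : 0 ≤ m) (h : ∀ x ∈ Set.Icc 0 s, 0 < (besselB m x).re)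
    {x : ℝ} (hx : x ∈ Set.Icc 0 s) : 0 < (besselB (m + 1) x).re := by
  rcases hx.1.eq_or_lt with rfl | hx0
  · simp [besselB_zero (m := m + 1) (by linarith)]
  · refine pos_of_mul_deriv_add_mul_pos (a := m + 1) (by linarith) hx0
      (fun y => hasDerivAt_re_besselB (m := m + 1) (by linarith) y) fun y hy => ?_
    have h1 := h y ⟨hy.1.le, hy.2.le.trans hx.2⟩
    rw [re_besselB_rec hm y] at h1
    have h2 : y * (-(besselB (m + 1 + 1) y).re / (m + 1 + 1)) + (m + 1) * (besselB (m + 1) y).re =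
      (m + 1) * ((besselB (m + 1) y).re - y / ((m + 1) * (m + 2)) * (besselB (m + 2) y).re) := by
      rw [show m + 1 + 1 = m + 2 by ring]
      field_simp
      ring
    rw [h2]
    positivity

/-- Otherwise s^(1/β) B_m increases as long as B_m > 0, so B_m has no first zero on [0, S], and
B_{m+1}, B_{m+2}, B_{m+3} are positive there too. Then B_{m+1} ≤ B_{m+2}, hence B_m + βS B_m' ≤
B_{m+1} (1 - S/((m+1)(m+2)) - βS/(m+1)) at S. The bracket vanishes by the choice of S, a
contradiction. -/
lemma exists_pos_and_add_deriv_nonpos {m β : ℝ} (hm : 0 ≤ m) (hβ : 0 < β) :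
    ∃ s, 0 < s ∧ s ≤ (m + 1) * (m + 2) / (β * (m + 2) + 1) ∧
      (∀ x ∈ Set.Icc 0 s, 0 < (besselB m x).re) ∧
      (besselB m s).re + β * (s * (-(besselB (m + 1) s).re / (m + 1))) ≤ 0 := by
  by_contra! hcon
  set S := (m + 1) * (m + 2) / (β * (m + 2) + 1) with hS
  have hS0 : 0 < S := by positivity
  have hc : Continuous fun x : ℝ => (besselB m x).re :=
    continuous_iff_continuousAt.2 fun x => (hasDerivAt_re_besselB hm x).continuousAt
  have hpos : ∀ x ∈ Set.Icc 0 S, 0 < (besselB m x).re := by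
    by_contra! hne
    have hK : IsCompact (Set.Icc 0 S ∩ {x : ℝ | (besselB m x).re ≤ 0}) :=
      isCompact_Icc.inter_right (isClosed_le hc continuous_const)
    obtain ⟨x0, hx0⟩ := hne
    obtain ⟨w, ⟨hw1, hw2⟩, hw3⟩ := hK.exists_isLeast ⟨x0, hx0⟩
    have hlt : ∀ x, 0 ≤ x → x < w → 0 < (besselB m x).re := by
      intro x hx hxw
      by_contra! hx'
      exact absurd (hw3 ⟨⟨hx, hxw.le.trans hw1.2⟩, hx'⟩) (not_le.2 hxw)
    have hw0 : 0 < w := by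
      refine lt_of_le_of_ne hw1.1 ?_
      rintro rfl
      simp [besselB_zero hm] at hw2
      linarith
    refine absurd (show (besselB m w).re ≤ 0 from hw2) (not_le.2 ?_)
    refine pos_of_mul_deriv_add_mul_pos (a := 1 / β) (by positivity) hw0
      (fun y => hasDerivAt_re_besselB hm y) fun y hy => ?_
    have h1 := hcon y hy.1 (hy.2.le.trans hw1.2) fun x hx => hlt x hx.1 (hx.2.trans_lt hy.2)
    have h2 := mul_pos (one_div_pos.2 hβ) h1
    rw [mul_add, ← mul_assoc (1 / β) β, one_div_mul_cancel hβ.ne'] at h2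
    linarith
  have h0 := hcon S hS0 le_rfl hpos
  have p1 := fun x hx => re_besselB_succ_pos hm hpos (x := x) hx
  have p2 := fun x hx => re_besselB_succ_pos (m := m + 1) (by linarith) p1 (x := x) hx
  have p3 := re_besselB_succ_pos (m := m + 1 + 1) (by linarith) p2 (Set.right_mem_Icc.2 hS0.le)
  have r1 := re_besselB_rec hm S
  have r2 := re_besselB_rec (m := m + 1) (by linarith) S
  have e2 : m + 1 + 1 = m + 2 := by ring
  rw [show m + 1 + 2 = m + 1 + 1 + 1 by ring] at r2
  rw [e2] at r2 p3
  have h1 : (besselB (m + 1) S).re ≤ (besselB (m + 2) S).re := by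
    have : 0 < S / ((m + 2) * (m + 2 + 1)) * (besselB (m + 2 + 1) S).re := by positivity
    linarith
  have h2 : S / ((m + 1) * (m + 2)) * (besselB (m + 1) S).re ≤
      S / ((m + 1) * (m + 2)) * (besselB (m + 2) S).re := by gcongr
  have h3 : (besselB (m + 1) S).re - S / ((m + 1) * (m + 2)) * (besselB (m + 1) S).re +
      β * (S * (-(besselB (m + 1) S).re / (m + 1))) = 0 := by
    rw [hS]
    field_simp
    ring
  rw [r1] at h0
  linarith

/-! ### Modulus estimates on disks, for the lower bounds. -/

/-- A continued-fraction style argument: the bound at index x+1 makes the last term of the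
recurrence at most |B_{x+1}|/(x+1), which leaves x |B_{x+1}| ≤ (x+1) |B_x|, and r ≤ x closes the
step. -/
lemma norm_besselB_succ_le {s : ℂ} {r : ℝ} (hr : 0 < r) (hs : ‖s‖ ≤ r) {m : ℝ} (hrm : r ≤ m) :
    besselB m s ≠ 0 ∧ r * ‖besselB (m + 1) s‖ ≤ (m + 1) * ‖besselB m s‖ := by
  have step : ∀ x : ℝ, r ≤ x →
      (besselB (x + 1) s ≠ 0 ∧ r * ‖besselB (x + 1 + 1) s‖ ≤ (x + 1 + 1) * ‖besselB (x + 1) s‖) →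
      (besselB x s ≠ 0 ∧ r * ‖besselB (x + 1) s‖ ≤ (x + 1) * ‖besselB x s‖) := by
    rintro x hx ⟨h1, h2⟩
    have hx0 : 0 < x := hr.trans_le hx
    have hrec := besselB_rec hx0.le s
    have hn : ‖s / (((x : ℂ) + 1) * (x + 2)) * besselB (x + 2) s‖ =
        ‖s‖ / ((x + 1) * (x + 2)) * ‖besselB (x + 2) s‖ := by
      rw [norm_mul, norm_div, norm_mul]
      congr 3
      · exact_mod_cast Real.norm_of_nonneg (by linarith : 0 ≤ x + 1)
      · exact_mod_cast Real.norm_of_nonneg (by linarith : 0 ≤ x + 2)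
    have h3 : ‖besselB (x + 1) s‖ - ‖s‖ / ((x + 1) * (x + 2)) * ‖besselB (x + 2) s‖ ≤
        ‖besselB x s‖ := by
      rw [hrec, ← hn]
      exact norm_sub_norm_le _ _
    rw [show x + 1 + 1 = x + 2 by ring] at h2
    have h4 : ‖s‖ / ((x + 1) * (x + 2)) * ‖besselB (x + 2) s‖ ≤ ‖besselB (x + 1) s‖ / (x + 1) := by
      have : ‖s‖ * ‖besselB (x + 2) s‖ ≤ (x + 2) * ‖besselB (x + 1) s‖ :=
        le_trans (by gcongr) h2
      calc _ = ‖s‖ * ‖besselB (x + 2) s‖ / ((x + 1) * (x + 2)) := by ring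
        _ ≤ (x + 2) * ‖besselB (x + 1) s‖ / ((x + 1) * (x + 2)) := by gcongr
        _ = _ := by field_simp
    have h5 : x * ‖besselB (x + 1) s‖ ≤ (x + 1) * ‖besselB x s‖ := by
      have : (x + 1) * (‖besselB (x + 1) s‖ - ‖besselB (x + 1) s‖ / (x + 1)) ≤
        (x + 1) * ‖besselB x s‖ := by gcongr; linarith
      calc _ = (x + 1) * (‖besselB (x + 1) s‖ - ‖besselB (x + 1) s‖ / (x + 1)) := by
            field_simp; ring
        _ ≤ _ := this
    have h6 : 0 < ‖besselB (x + 1) s‖ := norm_pos_iff.2 h1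
    refine ⟨norm_pos_iff.1 ?_, le_trans (by gcongr) h5⟩
    by_contra! h7
    nlinarith [mul_pos hx0 h6]
  have base : ∃ N : ℕ, besselB (m + N) s ≠ 0 ∧
      r * ‖besselB (m + N + 1) s‖ ≤ (m + N + 1) * ‖besselB (m + N) s‖ := by
    -- The first summand puts both values of B within 1/2 of 1; the second absorbs the ratio 4
    -- between the bounds 2 and 1/2 on their moduli.
    obtain ⟨N, hN⟩ := exists_nat_ge (2 * (‖s‖ * Real.exp ‖s‖) + 4 * r)
    refine ⟨N, ?_⟩
    have hE : 0 ≤ ‖s‖ * Real.exp ‖s‖ := by positivity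
    have key : ∀ y : ℝ, (N : ℝ) ≤ y → ‖besselB y s - 1‖ ≤ 1 / 2 := fun y hy => by
      have hy0 : (0 : ℝ) ≤ y := N.cast_nonneg.trans hy
      refine (norm_besselB_sub_one_le hy0 s).trans ?_
      rw [div_le_iff₀ (by linarith)]
      linarith
    have k1 := key (m + N) (by linarith)
    have k2 := key (m + N + 1) (by linarith)
    have l1 : 1 / 2 ≤ ‖besselB (m + N) s‖ := by
      have := norm_sub_norm_le 1 (besselB (m + N) s)
      rw [norm_sub_rev, norm_one] at this
      linarith
    have l2 : ‖besselB (m + N + 1) s‖ ≤ 2 := by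
      have := norm_sub_norm_le (besselB (m + N + 1) s) 1
      rw [norm_one] at this
      linarith
    refine ⟨norm_pos_iff.1 (by linarith), ?_⟩
    have : 4 * r ≤ m + N + 1 := by linarith
    nlinarith [norm_nonneg (besselB (m + N) s)]
  obtain ⟨N, hN⟩ := base
  induction N with
  | zero => simpa using hN
  | succ N ih =>
    apply ih
    apply step _ (le_add_of_le_of_nonneg hrm N.cast_nonneg)
    rw [Nat.cast_succ, ← add_assoc] at hN
    exact hN

/-- The recurrence gives |B_m| ≥ (1 - R/(m+1)²) |B_{m+1}|, so βR + R/(m+1) < m+1 suffices. At R =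
(m+1)/(1+β) this is strict because m > 0, which leaves room for a larger R. -/
lemma exists_starlike_bound {m β : ℝ} (hm : 0 < m) (hβ : 0 < β) :
    ∃ R, (m + 1) / (1 + β) < R ∧ ∀ s : ℂ, ‖s‖ ≤ R → besselB m s ≠ 0 ∧
      0 < (1 + β * (s * (-besselB (m + 1) s / (m + 1)) / besselB m s)).re := by
  set R0 := (m + 1) / (1 + β) with hR0
  have hR0pos : 0 < R0 := by positivity
  have hR0lt : R0 < m + 1 := by
    rw [hR0, div_lt_iff₀ (by positivity)]
    nlinarith
  have hlt : β * R0 + R0 / (m + 1) < m + 1 := by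
    have h1 : (1 + β) * R0 = m + 1 := by rw [hR0]; field_simp
    have h2 : R0 / (m + 1) < R0 := by
      rw [div_lt_iff₀ (by positivity)]
      nlinarith
    linarith
  obtain ⟨R, hR1, hR2, hR3⟩ : ∃ R, R0 < R ∧ R < m + 1 ∧ β * R + R / (m + 1) < m + 1 := by
    have hc : Continuous fun x : ℝ => β * x + x / (m + 1) := by fun_prop
    have e1 := (hc.tendsto R0).eventually (gt_mem_nhds hlt)
    have e2 : ∀ᶠ x in nhds R0, x < m + 1 := gt_mem_nhds hR0lt
    have e3 := (e1.and e2).filter_mono (nhdsWithin_le_nhds (s := Set.Ioi R0))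
    obtain ⟨x, hx, hx'⟩ := (e3.and self_mem_nhdsWithin).exists
    exact ⟨x, hx', hx.2, hx.1⟩
  refine ⟨R, hR1, fun s hs => ?_⟩
  have hRpos : 0 < R := hR0pos.trans hR1
  obtain ⟨a1, -⟩ := norm_besselB_succ_le hRpos hs (m := m + 1) hR2.le
  -- The largest admissible r at index m+1 gives the best constant.
  obtain ⟨-, b2⟩ := norm_besselB_succ_le (s := s) (r := m + 1) (by linarith) (hs.trans hR2.le)
    (m := m + 1) le_rfl
  rw [show m + 1 + 1 = m + 2 by ring] at b2
  have hA : 0 < ‖besselB (m + 1) s‖ := norm_pos_iff.2 a1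
  have hn : ‖s / (((m : ℂ) + 1) * (m + 2)) * besselB (m + 2) s‖ =
      ‖s‖ / ((m + 1) * (m + 2)) * ‖besselB (m + 2) s‖ := by
    rw [norm_mul, norm_div, norm_mul]
    congr 3
    · exact_mod_cast Real.norm_of_nonneg (by linarith : 0 ≤ m + 1)
    · exact_mod_cast Real.norm_of_nonneg (by linarith : 0 ≤ m + 2)
  have h3 : ‖besselB (m + 1) s‖ - ‖s‖ / ((m + 1) * (m + 2)) * ‖besselB (m + 2) s‖ ≤
      ‖besselB m s‖ := by
    rw [besselB_rec hm.le s, ← hn]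
    exact norm_sub_norm_le _ _
  have h4 : ‖s‖ / ((m + 1) * (m + 2)) * ‖besselB (m + 2) s‖ ≤
      R / (m + 1) / (m + 1) * ‖besselB (m + 1) s‖ := by
    calc _ ≤ R / ((m + 1) * (m + 2)) * ‖besselB (m + 2) s‖ := by gcongr
      _ = R / ((m + 1) * (m + 2)) / (m + 1) * ((m + 1) * ‖besselB (m + 2) s‖) := by field_simp
      _ ≤ R / ((m + 1) * (m + 2)) / (m + 1) * ((m + 2) * ‖besselB (m + 1) s‖) := by gcongr
      _ = _ := by field_simp
  have h5 : β * R * ‖besselB (m + 1) s‖ < (m + 1) * ‖besselB m s‖ := by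
    have h6 : (m + 1) * (R / (m + 1) / (m + 1)) = R / (m + 1) := by field_simp
    have h7 : (m + 1) * (‖besselB (m + 1) s‖ - R / (m + 1) / (m + 1) * ‖besselB (m + 1) s‖) ≤
        (m + 1) * ‖besselB m s‖ := by gcongr; linarith
    have h8 := mul_lt_mul_of_pos_right hR3 hA
    have h9 : (m + 1) * (‖besselB (m + 1) s‖ - R / (m + 1) / (m + 1) * ‖besselB (m + 1) s‖) =
      (m + 1) * ‖besselB (m + 1) s‖ - R / (m + 1) * ‖besselB (m + 1) s‖ := by
      field_simp
    linarith
  have hB : 0 < ‖besselB m s‖ := by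
    have : 0 < β * R * ‖besselB (m + 1) s‖ := by positivity
    exact pos_of_mul_pos_right (this.trans h5) (by linarith)
  refine ⟨norm_pos_iff.1 hB, ?_⟩
  have h6 : ‖(β : ℂ) * (s * (-besselB (m + 1) s / (m + 1)) / besselB m s)‖ < 1 := by
    have : ‖(m : ℂ) + 1‖ = m + 1 := by
      exact_mod_cast Real.norm_of_nonneg (by linarith : 0 ≤ m + 1)
    rw [norm_mul, norm_div, norm_mul, norm_div, norm_neg, this, Complex.norm_real,
      Real.norm_of_nonneg hβ.le]
    calc _ = β * ‖s‖ * ‖besselB (m + 1) s‖ / ((m + 1) * ‖besselB m s‖) := by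
          field_simp
      _ ≤ β * R * ‖besselB (m + 1) s‖ / ((m + 1) * ‖besselB m s‖) := by gcongr
      _ < 1 := by rwa [div_lt_one (by positivity)]
  have h7 := (abs_lt.1 ((Complex.abs_re_le_norm _).trans_lt h6)).1
  rw [Complex.add_re, Complex.one_re]
  linarith

/-! ### The k-gamma function and the reduction of f, g, h to B_m. -/

lemma kGamma_eq {k x : ℝ} (hk : 0 < k) (hx : 0 < x) :
    kGamma k x = k ^ (x / k - 1) * Real.Gamma (x / k) := by
  have h := integral_rpow_mul_exp_neg_mul_rpow (p := k) (q := x - 1) (b := 1 / k) hk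
    (by linarith) (by positivity)
  have h1 : kGamma k x = ∫ t in Set.Ioi (0 : ℝ), t ^ (x - 1) * Real.exp (-(1 / k) * t ^ k) := by
    unfold kGamma
    congr 1
    funext t
    congr 2
    ring
  rw [h1, h, sub_add_cancel, one_div, Real.inv_rpow hk.le, ← Real.rpow_neg hk.le, neg_div, neg_neg,
    Real.rpow_sub_one hk.ne']
  ring

lemma kGamma_pos {k x : ℝ} (hk : 0 < k) (hx : 0 < x) : 0 < kGamma k x := by
  rw [kGamma_eq hk hx]
  have := Real.Gamma_pos_of_pos (div_pos hx hk)
  positivity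

lemma kGamma_add {k x : ℝ} (hk : 0 < k) (hx : 0 < x) :
    kGamma k (x + k) = x * kGamma k x := by
  rw [kGamma_eq hk hx, kGamma_eq hk (by linarith), add_div, div_self hk.ne', add_sub_cancel_right,
    Real.Gamma_add_one (div_pos hx hk).ne', Real.rpow_sub_one hk.ne']
  field_simp

lemma kGamma_nat_mul_add {k ν : ℝ} (hk : 0 < k) (hν : 0 < ν) (n : ℕ) :
    kGamma k (n * k + ν + k) =
      kGamma k (ν + k) * (k ^ n * (ascPochhammer ℝ n).eval (ν / k + 1)) := by
  induction n with
  | zero => simp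
  | succ n ih =>
    rw [show ((n + 1 : ℕ) : ℝ) * k + ν + k = (n * k + ν + k) + k by push_cast; ring,
      kGamma_add hk (by positivity), ih, ascPochhammer_succ_eval]
    field_simp
    ring

lemma kBesselConst_mul_kBesselW {k ν : ℝ} (c : ℝ) (hk : 0 < k) (hν : 0 < ν) {z : ℂ}
    (hz : z ≠ 0) :
    (kBesselConst k ν : ℂ) * kBesselW k ν c z =
      z ^ ((ν : ℂ) / k) * besselB (ν / k) (((c / (4 * k) : ℝ) : ℂ) * z ^ 2) := by
  have hz2 : z / 2 ≠ 0 := div_ne_zero hz two_ne_zero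
  have hpow : ((2 : ℂ) ^ ((ν : ℂ) / k)) * (z / 2) ^ ((ν : ℂ) / k) = z ^ ((ν : ℂ) / k) := by
    -- Scaling by a positive real never crosses the branch cut.
    have hlog : Complex.log z = Real.log 2 + Complex.log (z / 2) := by
      have := Complex.log_ofReal_mul (r := 2) two_pos hz2
      rwa [Complex.ofReal_ofNat, mul_div_cancel₀ _ (two_ne_zero' ℂ)] at this
    rw [Complex.cpow_def_of_ne_zero two_ne_zero, Complex.cpow_def_of_ne_zero hz2,
      Complex.cpow_def_of_ne_zero hz, ← Complex.exp_add, hlog, Complex.ofReal_log two_pos.le,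
      Complex.ofReal_ofNat, add_mul]
  rw [kBesselW, besselB, ← tsum_mul_left, ← tsum_mul_left]
  congr 1
  funext n
  have hG := (kGamma_pos hk (add_pos hν hk)).ne'
  have hP := (one_pos.trans_le (one_le_eval_ascPochhammer (x := ν / k + 1)
    (by linarith [div_pos hν hk]) n)).ne'
  have hreal : kGamma k (ν + k) *
      ((-c) ^ n / ((n.factorial : ℝ) * kGamma k (n * k + ν + k))) * (1 / 2) ^ (2 * n) =
      besselCoeff (ν / k) n * (-(c / (4 * k))) ^ n := by
    have h4 : ((1 : ℝ) / 2) ^ (2 * n) = (1 / 4) ^ n := by rw [pow_mul]; norm_num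
    have h5 : (-(c / (4 * k))) ^ n = (-c) ^ n * (1 / 4) ^ n / k ^ n := by
      rw [← mul_pow, ← div_pow]; congr 1; field_simp
    rw [kGamma_nat_mul_add hk hν, h4, h5, besselCoeff]
    have hf : (0 : ℝ) < n.factorial := by positivity
    field_simp
  have hc : (kGamma k (ν + k) : ℂ) *
      (((-c) ^ n / ((n.factorial : ℝ) * kGamma k (n * k + ν + k)) : ℝ) : ℂ) * (1 / 2) ^ (2 * n) =
      besselCoeff (ν / k) n * (-((c / (4 * k) : ℝ) : ℂ)) ^ n := by
    have := congrArg Complex.ofReal hreal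
    push_cast at this ⊢
    exact this
  have hexp : (z / 2) ^ (2 * (n : ℂ) + (ν : ℂ) / k) =
      z ^ (2 * n) * (1 / 2) ^ (2 * n) * (z / 2) ^ ((ν : ℂ) / k) := by
    rw [Complex.cpow_add _ _ hz2, ← mul_pow, show 2 * (n : ℂ) = ((2 * n : ℕ) : ℂ) by push_cast; rfl,
      Complex.cpow_natCast]
    congr 2
    ring
  have hconst : (kBesselConst k ν : ℂ) = (2 : ℂ) ^ ((ν : ℂ) / k) * kGamma k (ν + k) := by
    rw [kBesselConst, Complex.ofReal_mul, Complex.ofReal_cpow two_pos.le]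
    push_cast
    rfl
  rw [hexp, hconst, ← neg_mul, mul_pow, ← pow_mul, ← hpow]
  linear_combination (2 : ℂ) ^ ((ν : ℂ) / k) * (z / 2) ^ ((ν : ℂ) / k) * z ^ (2 * n) * hc

lemma kBesselPhi_eq {k ν : ℝ} (c : ℝ) (hk : 0 < k) (hν : 0 < ν) :
    kBesselPhi k ν c = fun z => besselB (ν / k) (((c / (4 * k) : ℝ) : ℂ) * z ^ 2) := by
  funext z
  by_cases hz : z = 0
  · simp [kBesselPhi, hz, besselB_zero (div_pos hν hk).le]
  · have h := kBesselConst_mul_kBesselW c hk hν hz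
    rw [kBesselPhi, if_neg hz, mul_right_comm, h, mul_right_comm, ← Complex.cpow_add _ _ hz]
    simp

lemma kBesselG_eq {k ν : ℝ} (c : ℝ) (hk : 0 < k) (hν : 0 < ν) :
    kBesselG k ν c = fun z => z * besselB (ν / k) (((c / (4 * k) : ℝ) : ℂ) * z ^ 2) := by
  funext z
  by_cases hz : z = 0
  -- Every exponent 2n + ν/k is nonzero, so W(0) = 0 whatever value the prefactor takes at 0.
  · have h0 : kBesselW k ν c 0 = 0 := by
      rw [kBesselW]
      convert tsum_zero with n
      rw [zero_div, Complex.zero_cpow, mul_zero]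
      have : (0 : ℝ) < 2 * n + ν / k := by positivity
      exact_mod_cast this.ne'
    simp [kBesselG, hz, h0]
  · have h := kBesselConst_mul_kBesselW c hk hν hz
    rw [kBesselG, mul_right_comm, h, mul_right_comm, ← Complex.cpow_add _ _ hz]
    simp

lemma kBesselH_eq {k ν : ℝ} (c : ℝ) (hk : 0 < k) (hν : 0 < ν) :
    kBesselH k ν c = fun z => z * besselB (ν / k) (((c / (4 * k) : ℝ) : ℂ) * z) := by
  funext z
  by_cases hz : z = 0
  · have h0 : kBesselW k ν c 0 = 0 := by
      rw [kBesselW]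
      convert tsum_zero with n
      rw [zero_div, Complex.zero_cpow, mul_zero]
      have : (0 : ℝ) < 2 * n + ν / k := by positivity
      exact_mod_cast this.ne'
    simp [kBesselH, hz, h0]
  · have hz' : z ^ (1 / 2 : ℂ) ≠ 0 := by simp [Complex.cpow_eq_zero_iff, hz]
    have h := kBesselConst_mul_kBesselW c hk hν hz'
    have hsq : (z ^ (1 / 2 : ℂ)) ^ 2 = z := by
      rw [← Complex.cpow_nat_mul]; simp
    have him : (Complex.log z * (1 / 2)).im = z.arg / 2 := by
      rw [show (1 / 2 : ℂ) = ((1 / 2 : ℝ) : ℂ) by norm_num, Complex.im_mul_ofReal, Complex.log_im]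
      ring
    -- Exponents multiply since half the principal argument stays in (-π, π].
    have hpow : (z ^ (1 / 2 : ℂ)) ^ ((ν : ℂ) / k) = z ^ ((ν : ℂ) / (2 * k)) := by
      rw [← Complex.cpow_mul]
      · congr 1
        have : (k : ℂ) ≠ 0 := by exact_mod_cast hk.ne'
        field_simp
      · rw [him]; linarith [Complex.neg_pi_lt_arg z, Real.pi_pos]
      · rw [him]; linarith [Complex.arg_le_pi z, Real.pi_pos]
    rw [kBesselH, mul_right_comm, h, mul_right_comm, hsq, hpow, ← Complex.cpow_add _ _ hz]
    simp

/-! ### From quotient estimates to the radius. -/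

/-- Differentiability may be assumed at z: where it fails, z already lies in no admissible disk. -/
lemma radiusOfStarlikenessOfOrder_le {α : ℝ} {F : ℂ → ℂ} {z : ℂ} (hz : z ≠ 0)
    (h : DifferentiableAt ℂ F z → (z * deriv F z / F z).re ≤ α) :
    radiusOfStarlikenessOfOrder α F ≤ ‖z‖ := by
  refine Real.sSup_le ?_ (norm_nonneg z)
  rintro r ⟨-, hd, hr⟩
  by_contra! hlt
  have hmem : z ∈ Metric.ball (0 : ℂ) r := mem_ball_zero_iff.2 hlt
  exact absurd (hr z hmem hz)
    (not_lt.2 (h (hd.differentiableAt (Metric.isOpen_ball.mem_nhds hmem))))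

lemma le_radiusOfStarlikenessOfOrder {α r : ℝ} {F : ℂ → ℂ} {z : ℂ} (hz : z ≠ 0)
    (h : DifferentiableAt ℂ F z → (z * deriv F z / F z).re ≤ α) (hr : 0 < r)
    (hd : DifferentiableOn ℂ F (Metric.ball 0 r))
    (hF : ∀ z ∈ Metric.ball (0 : ℂ) r, z ≠ 0 → α < (z * deriv F z / F z).re) :
    r ≤ radiusOfStarlikenessOfOrder α F := by
  refine le_csSup ⟨‖z‖, ?_⟩ ⟨hr, hd, hF⟩
  rintro r' ⟨-, hd', hr'⟩
  by_contra! hlt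
  have hmem : z ∈ Metric.ball (0 : ℂ) r' := mem_ball_zero_iff.2 hlt
  exact absurd (hr' z hmem hz)
    (not_lt.2 (h (hd'.differentiableAt (Metric.isOpen_ball.mem_nhds hmem))))

/-- The common frame for f, g, h. The quotient formula is required only on zero-free disks and on
real segments where B_m > 0, since f may be ill-behaved elsewhere. -/
lemma radiusOfStarlikeness_bounds {F : ℂ → ℂ} {m β κ lo hi : ℝ} {p : ℕ} (hm : 0 < m)
    (hβ : 0 < β) (hκ : 0 < κ) (hp : p ≠ 0) (hhi : 0 ≤ hi)
    (hlo' : κ * lo ^ p ≤ (m + 1) / (1 + β))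
    (hhi' : (m + 1) * (m + 2) / (β * (m + 2) + 1) < κ * hi ^ p)
    (hdisk : ∀ r, (∀ z ∈ Metric.ball (0 : ℂ) r, besselB m (κ * z ^ p) ≠ 0) →
      DifferentiableOn ℂ F (Metric.ball 0 r) ∧ ∀ z ∈ Metric.ball (0 : ℂ) r, z ≠ 0 →
        z * deriv F z / F z = 1 + β * ((κ * z ^ p) *
          (-besselB (m + 1) (κ * z ^ p) / (m + 1)) / besselB m (κ * z ^ p)))
    (hreal : ∀ x : ℝ, 0 < x → (∀ t ∈ Set.Icc 0 (κ * x ^ p), 0 < (besselB m t).re) →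
      DifferentiableAt ℂ F x →
        x * deriv F x / F x = 1 + β * ((κ * (x : ℂ) ^ p) *
          (-besselB (m + 1) (κ * x ^ p) / (m + 1)) / besselB m (κ * x ^ p))) :
    lo < radiusOfStarlikeness F ∧ radiusOfStarlikeness F < hi := by
  have root : ∀ s : ℝ, 0 < s → ∃ x, 0 < x ∧ κ * x ^ p = s := fun s hs =>
    ⟨(s / κ) ^ ((p : ℝ)⁻¹), by positivity, by
      rw [Real.rpow_inv_natCast_pow (by positivity) hp]; field_simp⟩
  obtain ⟨s, hs0, hsle, hspos, hsneg⟩ := exists_pos_and_add_deriv_nonpos hm.le hβ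
  obtain ⟨x, hx0, hxs⟩ := root s hs0
  have hxhi : x < hi := by
    refine lt_of_pow_lt_pow_left₀ p hhi (lt_of_mul_lt_mul_left ?_ hκ.le)
    rw [hxs]
    exact hsle.trans_lt hhi'
  have hxC : (x : ℂ) ≠ 0 := by exact_mod_cast hx0.ne'
  have hq : DifferentiableAt ℂ F x → ((x : ℂ) * deriv F x / F x).re ≤ 0 := by
    intro hd
    have hsC : (κ : ℂ) * (x : ℂ) ^ p = s := by exact_mod_cast congrArg Complex.ofReal hxs
    rw [hreal x hx0 (by rwa [hxs]) hd, hsC, besselB_ofReal m, besselB_ofReal (m + 1)]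
    have hb := hspos s (Set.right_mem_Icc.2 hs0.le)
    have : 1 + β * (s * (-(besselB (m + 1) s).re / (m + 1)) / (besselB m s).re) ≤ 0 := by
      have h1 : 1 + β * (s * (-(besselB (m + 1) s).re / (m + 1)) / (besselB m s).re) =
          ((besselB m s).re + β * (s * (-(besselB (m + 1) s).re / (m + 1)))) /
            (besselB m s).re := by
        rw [add_div, div_self hb.ne', mul_div_assoc β]
      rw [h1]
      exact div_nonpos_of_nonpos_of_nonneg hsneg hb.le
    exact_mod_cast this
  have hnorm : ‖(x : ℂ)‖ = x := by rw [Complex.norm_real, Real.norm_of_nonneg hx0.le]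
  refine ⟨?_, (hnorm ▸ radiusOfStarlikenessOfOrder_le hxC hq).trans_lt hxhi⟩
  obtain ⟨R, hR, hstar⟩ := exists_starlike_bound hm hβ
  obtain ⟨r, hr0, hrR⟩ := root R (lt_trans (by positivity) hR)
  have hlor : lo < r := by
    refine lt_of_pow_lt_pow_left₀ p hr0.le (lt_of_mul_lt_mul_left ?_ hκ.le)
    rw [hrR]
    exact hlo'.trans_lt hR
  have hle : ∀ z ∈ Metric.ball (0 : ℂ) r, ‖(κ : ℂ) * z ^ p‖ ≤ R := fun z hz => by
    rw [norm_mul, norm_pow, Complex.norm_real, Real.norm_of_nonneg hκ.le, ← hrR]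
    have := (mem_ball_zero_iff.1 hz).le
    gcongr
  obtain ⟨hd, hquot⟩ := hdisk r fun z hz => (hstar _ (hle z hz)).1
  refine hlor.trans_le (le_radiusOfStarlikenessOfOrder hxC hq hr0 hd fun z hz hz0 => ?_)
  rw [hquot z hz hz0]
  exact (hstar _ (hle z hz)).2

lemma hasDerivAt_besselB_comp {m : ℝ} (hm : 0 ≤ m) (κ z : ℂ) (p : ℕ) :
    HasDerivAt (fun z : ℂ => besselB m (κ * z ^ p))
      (-besselB (m + 1) (κ * z ^ p) / (m + 1) * (κ * (p * z ^ (p - 1)))) z :=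
  HasDerivAt.comp (h₂ := besselB m) (h := fun z => κ * z ^ p) z (hasDerivAt_besselB hm (κ * z ^ p))
    ((hasDerivAt_pow p z).const_mul κ)

lemma radiusOfStarlikeness_mul_besselB_bounds {m κ lo hi : ℝ} {p : ℕ} (hm : 0 < m) (hκ : 0 < κ)
    (hp : p ≠ 0) (hhi : 0 ≤ hi) (hlo' : κ * lo ^ p ≤ (m + 1) / (1 + p))
    (hhi' : (m + 1) * (m + 2) / (p * (m + 2) + 1) < κ * hi ^ p) :
    lo < radiusOfStarlikeness (fun z => z * besselB m (κ * z ^ p)) ∧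
      radiusOfStarlikeness (fun z => z * besselB m (κ * z ^ p)) < hi := by
  have hderiv : ∀ z : ℂ, HasDerivAt (fun z => z * besselB m (κ * z ^ p))
      (1 * besselB m (κ * z ^ p) +
        z * (-besselB (m + 1) (κ * z ^ p) / (m + 1) * (κ * (p * z ^ (p - 1))))) z :=
    fun z => (hasDerivAt_id z).mul (hasDerivAt_besselB_comp hm.le κ z p)
  have hquot : ∀ z : ℂ, z ≠ 0 → besselB m (κ * z ^ p) ≠ 0 →
      z * deriv (fun z => z * besselB m (κ * z ^ p)) z / (z * besselB m (κ * z ^ p)) =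
        1 + ((p : ℝ) : ℂ) * ((κ * z ^ p) *
          (-besselB (m + 1) (κ * z ^ p) / (m + 1)) / besselB m (κ * z ^ p)) := by
    intro z hz hB
    have hzp : z ^ p = z * z ^ (p - 1) := (mul_pow_sub_one hp z).symm
    rw [(hderiv z).deriv, mul_div_mul_left _ _ hz, add_div, one_mul, div_self hB,
      Complex.ofReal_natCast]
    generalize besselB (m + 1) (κ * z ^ p) / (m + 1) = A
    generalize besselB m (κ * z ^ p) = B at hB
    rw [hzp]
    ring
  refine radiusOfStarlikeness_bounds (p := p) (β := p) hm (by positivity) hκ hp hhi hlo' hhi'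
    (fun r hr => ⟨fun z _ => (hderiv z).differentiableAt.differentiableWithinAt,
      fun z hz hz0 => hquot z hz0 (hr z hz)⟩) fun x hx hpos _ => ?_
  refine hquot x (by exact_mod_cast hx.ne') fun h0 => ?_
  have h1 := hpos _ (Set.right_mem_Icc.2 (by positivity))
  push_cast at h1
  simp [h0] at h1

/-! ### The branch of the power defining f. -/

/-- The segment integral of `φ' / φ` is the increment of any primitive along the segment. -/
lemma logBranch_eq_sub {φ G : ℂ → ℂ} {z : ℂ} (hφ : Differentiable ℂ φ)
    (hne : ∀ t ∈ Set.Icc (0 : ℝ) 1, φ (t * z) ≠ 0)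
    (hG : ∀ t ∈ Set.Icc (0 : ℝ) 1, HasDerivAt G (deriv φ (t * z) / φ (t * z)) (t * z)) :
    logBranch φ z = G z - G 0 := by
  have hline : ∀ t : ℝ, HasDerivAt (fun t : ℝ => (t : ℂ) * z) z t := fun t => by
    simpa using (Complex.ofRealCLM.hasDerivAt (x := t)).mul_const z
  have h := intervalIntegral.integral_eq_sub_of_hasDerivAt (a := 0) (b := 1)
    (f := fun t : ℝ => G (t * z))
    (f' := fun t : ℝ => z * deriv φ (t * z) / φ (t * z)) (fun t ht => ?_) ?_
  · simpa [logBranch] using h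
  · rw [Set.uIcc_of_le zero_le_one] at ht
    have h1 := HasDerivAt.comp (h₂ := G) (h := fun t : ℝ => (t : ℂ) * z) t (hG t ht) (hline t)
    rwa [div_mul_eq_mul_div, mul_comm (deriv φ _)] at h1
  · apply ContinuousOn.intervalIntegrable
    rw [Set.uIcc_of_le zero_le_one]
    have hl : Continuous fun t : ℝ => (t : ℂ) * z := by fun_prop
    have hφ' : Continuous (deriv φ) := (hφ.contDiff (n := 1)).continuous_deriv le_rfl
    exact ((continuous_const.mul (hφ'.comp hl)).continuousOn).div
      ((hφ.continuous.comp hl).continuousOn) hne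

/-- On a disk about the origin where `φ` has no zero, `logBranch φ` is a primitive of `φ' / φ`. -/
lemma hasDerivAt_logBranch {φ : ℂ → ℂ} {r : ℝ} (hφ : Differentiable ℂ φ)
    (hne : ∀ z ∈ Metric.ball (0 : ℂ) r, φ z ≠ 0) {z : ℂ} (hz : z ∈ Metric.ball (0 : ℂ) r) :
    HasDerivAt (logBranch φ) (deriv φ z / φ z) z := by
  have hφ' : Differentiable ℂ (deriv φ) := fun w =>
    (hφ.analyticAt w).deriv.differentiableAt
  obtain ⟨G, hG⟩ := (DifferentiableOn.isExactOn_ball (f := fun w => deriv φ w / φ w)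
    (c := 0) (r := r) (hφ'.differentiableOn.div hφ.differentiableOn hne))
  have hseg : ∀ w ∈ Metric.ball (0 : ℂ) r, ∀ t ∈ Set.Icc (0 : ℝ) 1,
      (t : ℂ) * w ∈ Metric.ball (0 : ℂ) r := fun w hw t ht => by
    rw [mem_ball_zero_iff] at hw ⊢
    rw [norm_mul, Complex.norm_real, Real.norm_of_nonneg ht.1]
    exact (mul_le_of_le_one_left (norm_nonneg w) ht.2).trans_lt hw
  have heq : ∀ w ∈ Metric.ball (0 : ℂ) r, logBranch φ w = G w - G 0 := fun w hw =>
    logBranch_eq_sub hφ (fun t ht => hne _ (hseg w hw t ht)) fun t ht => hG _ (hseg w hw t ht)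
  refine ((hG z hz).sub_const (G 0)).congr_of_eventuallyEq ?_
  filter_upwards [Metric.isOpen_ball.mem_nhds hz] with w hw using heq w hw

lemma hasDerivAt_mul_exp {L : ℂ → ℂ} {L' a z : ℂ} (hL : HasDerivAt L L' z) :
    HasDerivAt (fun z => z * Complex.exp (a * L z))
      ((1 + a * (z * L')) * Complex.exp (a * L z)) z := by
  refine ((hasDerivAt_id' z).mul (hL.const_mul a).cexp).congr_deriv ?_
  ring

lemma mul_div_mul_exp {z E q : ℂ} (hz : z ≠ 0) (hE : E ≠ 0) : z * (q * E) / (z * E) = q := by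
  field_simp

/-- Starlikeness bounds for `z ↦ z φ(z)^a` with `φ z = B(κ z ^ 2)`. -/
lemma radiusOfStarlikeness_mul_exp_logBranch_bounds {m κ a lo hi : ℝ} (hm : 0 < m) (hκ : 0 < κ)
    (ha : 0 < a) (hhi : 0 ≤ hi) (hlo' : κ * lo ^ 2 ≤ (m + 1) / (1 + 2 * a))
    (hhi' : (m + 1) * (m + 2) / (2 * a * (m + 2) + 1) < κ * hi ^ 2) :
    lo < radiusOfStarlikeness
        (fun z => z * Complex.exp (a * logBranch (fun z => besselB m (κ * z ^ 2)) z)) ∧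
      radiusOfStarlikeness
        (fun z => z * Complex.exp (a * logBranch (fun z => besselB m (κ * z ^ 2)) z)) < hi := by
  set φ : ℂ → ℂ := fun z => besselB m (κ * z ^ 2) with hφdef
  have hderiv : ∀ z : ℂ, HasDerivAt φ
      (-besselB (m + 1) (κ * z ^ 2) / (m + 1) * (κ * (2 * z))) z := fun z => by
    simpa using hasDerivAt_besselB_comp hm.le κ z 2
  have hφ : Differentiable ℂ φ := fun z => (hderiv z).differentiableAt
  have hq : ∀ z : ℂ, 1 + (a : ℂ) * (z * (deriv φ z / φ z)) =
      1 + ((2 * a : ℝ) : ℂ) * ((κ * z ^ 2) *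
          (-besselB (m + 1) (κ * z ^ 2) / (m + 1)) / besselB m (κ * z ^ 2)) := fun z => by
    rw [(hderiv z).deriv]
    push_cast
    ring
  refine radiusOfStarlikeness_bounds (p := 2) (β := 2 * a) hm (by positivity) hκ two_ne_zero hhi
    hlo' hhi' (fun r hr => ?_) fun x hx hpos hd => ?_
  · have hF := fun z hz => hasDerivAt_mul_exp (a := a) (hasDerivAt_logBranch hφ hr (z := z) hz)
    refine ⟨fun z hz => (hF z hz).differentiableAt.differentiableWithinAt, fun z hz hz0 => ?_⟩
    rw [(hF z hz).deriv, mul_div_mul_exp hz0 (Complex.exp_ne_zero _), hq]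
  -- φ is not known to be zero-free on the disk of radius x, so `logBranch φ` is identified with log
  -- φ only on [0, x]. Since F is assumed differentiable at x, the one-sided derivative along this
  -- segment determines `deriv F x`.
  · have hslit : ∀ y ∈ Set.Icc 0 x, φ y ∈ Complex.slitPlane := fun y hy => by
      have h1 := hpos (κ * y ^ 2) ⟨by have := hy.1; positivity, by
        have := hy.1; have := hy.2; gcongr⟩
      push_cast at h1
      exact Or.inl h1
    have hlog : ∀ y ∈ Set.Icc 0 x, HasDerivAt (fun z => Complex.log (φ z))
        (deriv φ y / φ y) (y : ℂ) := fun y hy =>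
      (hφ y).hasDerivAt.clog (hslit y hy)
    have hseg : ∀ y ∈ Set.Icc 0 x, ∀ t ∈ Set.Icc (0 : ℝ) 1, t * y ∈ Set.Icc 0 x :=
      fun y hy t ht => ⟨mul_nonneg ht.1 hy.1, (mul_le_of_le_one_left hy.1 ht.2).trans hy.2⟩
    have heq : ∀ y ∈ Set.Icc 0 x, logBranch φ (y : ℂ) = Complex.log (φ y) := fun y hy => by
      rw [logBranch_eq_sub (G := fun z => Complex.log (φ z)) hφ
        (fun t ht => by
          have := Complex.slitPlane_ne_zero (hslit _ (hseg y hy t ht))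
          rwa [Complex.ofReal_mul] at this)
        (fun t ht => by
          have := hlog _ (hseg y hy t ht)
          rwa [Complex.ofReal_mul] at this)]
      simp [hφdef, besselB_zero hm.le]
    have hxm : x ∈ Set.Icc 0 x := Set.right_mem_Icc.2 hx.le
    have h1 := (hasDerivAt_mul_exp (a := (a : ℂ)) (hlog x hxm)).comp_ofReal
    have h2 := hd.hasDerivAt.comp_ofReal
    have h3 := h1.hasDerivWithinAt (s := Set.Icc 0 x)
    have h4 := (h2.hasDerivWithinAt (s := Set.Icc 0 x)).congr
      (f₁ := fun y : ℝ => (y : ℂ) * Complex.exp (a * Complex.log (φ y)))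
      (fun y hy => by rw [heq y hy]) (by rw [heq x hxm])
    have h5 := (uniqueDiffOn_Icc hx x hxm).eq_deriv _ h4 h3
    rw [h5, heq x hxm, mul_div_mul_exp (by exact_mod_cast hx.ne') (Complex.exp_ne_zero _), hq]

/-! ### Comparison of the thresholds with the stated bounds. -/

theorem theorem2 (k c ν : ℝ) (hk : 0 < k) (hc : 0 < c) (hν : 0 < ν) :
    (2 * √(ν * (ν + k) / (c * (ν + 2 * k))) < radiusOfStarlikeness (kBesselF k ν c) ∧
      radiusOfStarlikeness (kBesselF k ν c) <
        2 * (ν + 2 * k) *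
          √(ν * (ν + k) / (c * ((ν + 2 * k) ^ 3 - ν * (ν + k) * (ν + 4 * k))))) ∧
    (2 * √((ν + k) / (3 * c)) < radiusOfStarlikeness (kBesselG k ν c) ∧
      radiusOfStarlikeness (kBesselG k ν c) <
        2 * √(3 * (ν + k) * (ν + 2 * k) / (c * (4 * ν + 13 * k)))) ∧
    (2 * (ν + k) / c < radiusOfStarlikeness (kBesselH k ν c) ∧
      radiusOfStarlikeness (kBesselH k ν c) <
        8 * (ν + k) * (ν + 2 * k) / (c * (ν + 5 * k))) := by
  have hm : 0 < ν / k := by positivity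
  have hκ : 0 < c / (4 * k) := by positivity
  refine ⟨?_, ?_, ?_⟩
  · have hF : kBesselF k ν c = fun z => z * Complex.exp (((k / ν : ℝ) : ℂ) *
        logBranch (fun z => besselB (ν / k) (((c / (4 * k) : ℝ) : ℂ) * z ^ 2)) z) := by
      funext z
      rw [kBesselF, kBesselPhi_eq c hk hν, Complex.ofReal_div k ν]
    have hden : (ν + 2 * k) ^ 3 - ν * (ν + k) * (ν + 4 * k) =
        k * (ν ^ 2 + 8 * ν * k + 8 * k ^ 2) := by ring
    rw [hF, hden]
    refine radiusOfStarlikeness_mul_exp_logBranch_bounds hm hκ (by positivity) (by positivity)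
      (le_of_eq ?_) ?_
    · rw [mul_pow, Real.sq_sqrt (by positivity)]
      field_simp
      ring
    · rw [mul_pow, Real.sq_sqrt (by positivity)]
      have e1 : (ν / k + 1) * (ν / k + 2) / (2 * (k / ν) * (ν / k + 2) + 1) =
          ν * (ν + k) * (ν + 2 * k) / (k ^ 2 * (3 * ν + 4 * k)) := by
        field_simp
        ring
      have e2 : c / (4 * k) * ((2 * (ν + 2 * k)) ^ 2 *
          (ν * (ν + k) / (c * (k * (ν ^ 2 + 8 * ν * k + 8 * k ^ 2))))) =
          ν * (ν + k) * (ν + 2 * k) * (ν + 2 * k) /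
            (k ^ 2 * (ν ^ 2 + 8 * ν * k + 8 * k ^ 2)) := by
        field_simp
        norm_num
      rw [e1, e2, div_lt_div_iff₀ (by positivity) (by positivity), ← sub_pos]
      -- After cross-multiplication the difference is a polynomial with positive coefficients;
      -- likewise for g and h.
      have e3 : ν * (ν + k) * (ν + 2 * k) * (ν + 2 * k) * (k ^ 2 * (3 * ν + 4 * k)) -
          ν * (ν + k) * (ν + 2 * k) * (k ^ 2 * (ν ^ 2 + 8 * ν * k + 8 * k ^ 2)) =
          ν * (ν + k) * (ν + 2 * k) * k ^ 2 * (2 * ν ^ 2 + 2 * ν * k) := by ring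
      rw [e3]
      positivity
  · rw [kBesselG_eq c hk hν]
    refine radiusOfStarlikeness_mul_besselB_bounds hm hκ two_ne_zero (by positivity)
      (le_of_eq ?_) ?_
    · rw [mul_pow, Real.sq_sqrt (by positivity)]
      push_cast
      field_simp
      ring
    · rw [mul_pow, Real.sq_sqrt (by positivity)]
      have e1 : (ν / k + 1) * (ν / k + 2) / ((2 : ℕ) * (ν / k + 2) + 1) =
          (ν + k) * (ν + 2 * k) / (k * (2 * ν + 5 * k)) := by
        push_cast
        field_simp
        ring
      have e2 : c / (4 * k) * (2 ^ 2 * (3 * (ν + k) * (ν + 2 * k) / (c * (4 * ν + 13 * k)))) =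
          3 * (ν + k) * (ν + 2 * k) / (k * (4 * ν + 13 * k)) := by
        field_simp
        norm_num
      rw [e1, e2, div_lt_div_iff₀ (by positivity) (by positivity), ← sub_pos]
      have e3 : 3 * (ν + k) * (ν + 2 * k) * (k * (2 * ν + 5 * k)) -
          (ν + k) * (ν + 2 * k) * (k * (4 * ν + 13 * k)) =
          (ν + k) * (ν + 2 * k) * k * (2 * ν + 2 * k) := by ring
      rw [e3]
      positivity
  · have hH : kBesselH k ν c = fun z => z * besselB (ν / k) (((c / (4 * k) : ℝ) : ℂ) * z ^ 1) := by
      simpa using kBesselH_eq c hk hν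
    rw [hH]
    refine radiusOfStarlikeness_mul_besselB_bounds hm hκ one_ne_zero (by positivity)
      (le_of_eq ?_) ?_
    · push_cast
      field_simp
      ring
    · have e1 : (ν / k + 1) * (ν / k + 2) / ((1 : ℕ) * (ν / k + 2) + 1) =
          (ν + k) * (ν + 2 * k) / (k * (ν + 3 * k)) := by
        push_cast
        field_simp
        ring
      have e2 : c / (4 * k) * (8 * (ν + k) * (ν + 2 * k) / (c * (ν + 5 * k))) ^ 1 =
          2 * (ν + k) * (ν + 2 * k) / (k * (ν + 5 * k)) := by
        field_simp
        ring
      rw [e1, e2, div_lt_div_iff₀ (by positivity) (by positivity), ← sub_pos]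
      have e3 : 2 * (ν + k) * (ν + 2 * k) * (k * (ν + 3 * k)) -
          (ν + k) * (ν + 2 * k) * (k * (ν + 5 * k)) =
          (ν + k) * (ν + 2 * k) * k * (ν + k) := by ring
      rw [e3]
      positivity
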